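/- Let $A$ be a $C^*$-algebra, not necessarily unital. An element $u\in A$ is called a partial isometry if $u^*u$ is a projection (a self-adjoint idempotent), and two partial isometries $u,v\in A$ are called homotopic through partial isometries in $A$ if there is a norm-continuous map $\gamma\colon[0,1]\to A$ with $\gamma(0)=u$, $\gamma(1)=v$ and $\gamma(t)$ a partial isometry for every $t\in[0,1]$. (i) If $u$ and $v$ are partial isometries in a $C^*$-algebra $A$ with $\|u-v\|<1$, then $u$ and $v$ are homotopic through partial isometries in $A$. (ii) The constant $1$ is sharp: if $u=0$ and $v\neq 0$ is any nonzero partial isometry in a $C^*$-algebra $A$, then $u$ and $v$ are partial isometries with $\|u-v\|=1$ that are not homotopic through partial isometries in $A$; and there are $C^*$-algebras that contain a nonzero partial isometry. -/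

import Mathlib

universe w

/-- An element `u` of a (not necessarily unital) C*-algebra is a partial isometry if
`u* u` is a projection, i.e. a self-adjoint idempotent. -/
def IsPartialIsometry {A : Type w} [NonUnitalCStarAlgebra A] (u : A) : Prop :=
  IsStarProjection (star u * u)

/-- `u` and `v` are homotopic through partial isometries in `A`: there is a norm-continuous path
on `[0, 1]` from `u` to `v`, all of whose values are partial isometries in `A`. -/
def HomotopicThroughPartialIsometries {A : Type w} [NonUnitalCStarAlgebra A] (u v : A) : Prop :=
  JoinedIn {x : A | IsPartialIsometry x} u v

/-! ### Norms of partial isometries -/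

namespace IsPartialIsometry

variable {A : Type w} [NonUnitalCStarAlgebra A] {u v : A}

/-! Put `e = u u*` and `p = u* u`. Both `u` and `v` are joined to the polar part of `e v p`. Each
path is the polar part of `(1 + t l) w (1 + t r)`, with `w` the starting partial isometry and `l`,
`r` of norm at most `c = ‖u - v‖ < 1`. The outer factors are invertible, so these elements have
generalized inverses bounded uniformly in `t`. This gives a uniform gap above `0` in the
quasispectrum of `x* x` (`quasispectrum_gap`), where a single continuous function computes the polar
part. For `w = v` the bounds on `l`, `r` rest on `norm_support_sub_le`.

Sharpness: a partial isometry has norm `0` or `1`, and the norm is continuous along a path. -/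

theorem mul_star_mul_self (hu : IsPartialIsometry u) : u * (star u * u) = u := by
  have h2 : star u * u * (star u * u) = star u * u := hu.isIdempotentElem
  rw [← sub_eq_zero, ← CStarRing.star_mul_self_eq_zero_iff]
  have : star (u * (star u * u) - u) * (u * (star u * u) - u) =
      (star u * u * (star u * u)) * (star u * u) - star u * u * (star u * u)
        - star u * u * (star u * u) + star u * u := by
    simp only [star_sub, star_mul, star_star]
    noncomm_ring
  rw [this, h2, h2]
  noncomm_ring

theorem isPartialIsometry_star (hu : IsPartialIsometry u) : IsPartialIsometry (star u) := by
  refine ⟨?_, ?_⟩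
  · rw [star_star]
    show u * star u * (u * star u) = u * star u
    rw [mul_assoc, ← mul_assoc (star u), ← mul_assoc, hu.mul_star_mul_self]
  · simp [IsSelfAdjoint]

theorem norm_le_one (hu : IsPartialIsometry u) : ‖u‖ ≤ 1 := by
  have h : ‖u‖ * ‖u‖ ≤ 1 := CStarRing.norm_star_mul_self (x := u) ▸ IsStarProjection.norm_le _ hu
  nlinarith [norm_nonneg u]

theorem norm_eq_one (hu : IsPartialIsometry u) (h0 : u ≠ 0) : ‖u‖ = 1 := by
  refine le_antisymm hu.norm_le_one ?_
  have h := norm_mul_le u (star u * u)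
  rw [hu.mul_star_mul_self, CStarRing.norm_star_mul_self] at h
  have := norm_pos_iff.2 h0
  nlinarith

theorem zero : IsPartialIsometry (0 : A) := by
  simp [IsPartialIsometry, IsStarProjection.zero]

theorem not_homotopic_zero (hv : v ≠ 0) :
    ¬ HomotopicThroughPartialIsometries (0 : A) v := by
  rintro ⟨γ, hγ⟩
  have hc : Continuous fun t => ‖γ t‖ := by fun_prop
  have hv1 : ‖v‖ = 1 := norm_eq_one (by simpa using hγ 1) hv
  obtain ⟨t, ht⟩ := mem_range_of_exists_le_of_exists_ge hc (c := (1 / 2 : ℝ))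
    ⟨0, by simp⟩ ⟨1, by simp [hv1]; norm_num⟩
  have ht' : ‖γ t‖ = 1 / 2 := ht
  by_cases h0 : γ t = 0
  · simp [h0] at ht'
  · rw [norm_eq_one (hγ t) h0] at ht'
    norm_num at ht'

end IsPartialIsometry

/-! ### Distance between projections, and inverses near `1` -/

section Projections

variable {B : Type*} [CStarAlgebra B] {p q : B}

/-- `|p - q|²` splits as `|(1 - q)p|² + |q(1 - p)|²`, whose terms live in the orthogonal corners of
`p` and `1 - p`; hence a maximum and not a sum. -/
theorem IsStarProjection.norm_sub_sq_le (hp : IsStarProjection p) (hq : IsStarProjection q) :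
    ‖p - q‖ ^ 2 ≤ max (‖p - q * p‖ ^ 2) (‖q - q * p‖ ^ 2) := by
  let _ := CStarAlgebra.spectralOrder B
  let _ := CStarAlgebra.spectralOrderedRing B
  have hpp : p * p = p := hp.isIdempotentElem
  have hqq : q * q = q := hq.isIdempotentElem
  have hps : star p = p := hp.isSelfAdjoint
  have hqs : star q = q := hq.isSelfAdjoint
  set c := max (‖p - q * p‖ ^ 2) (‖q - q * p‖ ^ 2) with hc
  have key : ∀ r x : B, IsStarProjection r → x * r = x → ‖x‖ ^ 2 ≤ c → star x * x ≤ c • r := by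
    intro r x hr hx hxc
    have h := CStarAlgebra.star_left_conjugate_le_norm_smul (a := r) (b := star x * x)
      (IsSelfAdjoint.star_mul_self x)
    have hrr : r * r = r := hr.isIdempotentElem
    have hrs : star r = r := hr.isSelfAdjoint
    have hx' : r * star x = star x := by rw [← hrs, ← star_mul, hx]
    rw [hrs, ← mul_assoc r, hx', mul_assoc, hx, hrr, CStarRing.norm_star_mul_self, ← sq] at h
    exact h.trans (smul_le_smul_of_nonneg_right hxc hr.nonneg)
  have h1 := key p (p - q * p) hp (by rw [sub_mul, mul_assoc, hpp]) (le_max_left _ _)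
  have h2 := key (1 - p) (q - q * p) hp.one_sub
    (by simp only [mul_sub, sub_mul, mul_one, mul_assoc, hpp]; abel) (le_max_right _ _)
  have h3 : star (p - q) * (p - q) ≤ algebraMap ℝ B c := by
    calc star (p - q) * (p - q)
        = star (p - q * p) * (p - q * p) + star (q - q * p) * (q - q * p) := by
          simp only [star_sub, star_mul, hps, hqs, mul_sub, sub_mul, mul_assoc, hpp, hqq]
          simp only [← mul_assoc q q, hqq]
          abel
      _ ≤ c • p + c • (1 - p) := add_le_add h1 h2
      _ = algebraMap ℝ B c := by
          rw [← smul_add, add_sub_cancel, Algebra.algebraMap_eq_smul_one]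
  have := (CStarAlgebra.norm_le_iff_le_algebraMap _ (by positivity) (star_mul_self_nonneg _)).2 h3
  rwa [CStarRing.norm_star_mul_self, ← sq] at this

end Projections

theorem exists_inverse_one_add {B : Type*} [CStarAlgebra B] {x : B} {c : ℝ} (hc : c < 1)
    (hx : ‖x‖ ≤ c) : ∃ n : B, n * (1 + x) = 1 ∧ (1 + x) * n = 1 ∧ ‖n‖ ≤ (1 - c)⁻¹ := by
  have hx1 : ‖-x‖ < 1 := by rw [norm_neg]; linarith
  obtain ⟨n, hn⟩ : ∃ n : Bˣ, (n : B) = 1 + x := ⟨Units.oneSub (-x) hx1, by simp⟩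
  refine ⟨(n⁻¹ : Bˣ), by simp [← hn], by simp [← hn], ?_⟩
  have h1 : ((n⁻¹ : Bˣ) : B) = 1 - x * (n⁻¹ : Bˣ) := by
    have : (1 + x) * ((n⁻¹ : Bˣ) : B) = 1 := by simp [← hn]
    rw [eq_sub_iff_add_eq, ← this]; noncomm_ring
  have h2 : ‖((n⁻¹ : Bˣ) : B)‖ ≤ 1 + c * ‖((n⁻¹ : Bˣ) : B)‖ := by
    calc _ = ‖1 - x * ((n⁻¹ : Bˣ) : B)‖ := by rw [← h1]
      _ ≤ ‖(1 : B)‖ + ‖x * ((n⁻¹ : Bˣ) : B)‖ := norm_sub_le _ _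
      _ ≤ 1 + c * ‖((n⁻¹ : Bˣ) : B)‖ := by
        gcongr
        · exact IsStarProjection.norm_le _ (.one B)
        · exact (norm_mul_le _ _).trans (by gcongr)
  exact (le_div_iff₀ (by linarith)).2 (by linarith) |>.trans_eq (one_div _)

/-! ### Spectral gap and polar part -/

section PolarPart

variable {A : Type w} [NonUnitalCStarAlgebra A]

/-- `x` has a generalized inverse of norm at most `C` in the unitization. -/
def HasGeneralizedInverse (C : ℝ) (x : A) : Prop :=
  ∃ y : Unitization ℂ A, (x : Unitization ℂ A) * y * x = x ∧ ‖y‖ ≤ C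

theorem star_mul_self_quasispectrum_nonneg (x : A) {s : ℝ}
    (hs : s ∈ quasispectrum ℝ (star x * x)) : 0 ≤ s := by
  let _ := CStarAlgebra.spectralOrder A
  let _ := CStarAlgebra.spectralOrderedRing A
  exact quasispectrum_nonneg_of_nonneg _ (star_mul_self_nonneg x) s hs

/-- A generalized inverse of `x` opens a gap above `0` in the quasispectrum of `star x * x`. -/
theorem HasGeneralizedInverse.quasispectrum_gap {C δ : ℝ} {x : A} (hx : HasGeneralizedInverse C x)
    (hδ : 0 ≤ δ) (hCδ : C ^ 2 * δ < 1) {s : ℝ} (hs : s ∈ quasispectrum ℝ (star x * x)) :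
    s = 0 ∨ δ ≤ s := by
  obtain ⟨y, hy, hyC⟩ := hx
  have hC : 0 ≤ C := (norm_nonneg y).trans hyC
  set a := star x * x with ha
  have hsa : IsSelfAdjoint a := IsSelfAdjoint.star_mul_self x
  -- On `r ≥ 0`, `h` is nonzero exactly on `(0, δ)`. Its extra factor `r` makes `H` end in `star x *
  -- x`, whence `H y x = H`. Then `‖H‖² ≤ C ‖H‖ ‖x H‖` and `‖x H‖² ≤ δ ‖H‖²` force `H = 0`.
  let k : ℝ → ℝ := fun r => r * max 0 (δ - r)
  let h : ℝ → ℝ := fun r => k r * r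
  have hk : Continuous k := by fun_prop
  have hh : Continuous h := by fun_prop
  have h_eq : cfcₙ h a = cfcₙ k a * a := by
    rw [cfcₙ_mul k (fun r => r) a hk.continuousOn (by simp [k]) continuousOn_id rfl,
      cfcₙ_id' ℝ a hsa]
  set H := cfcₙ h a with hH
  have hHsa : star H = H := (cfcₙ_predicate h a : IsSelfAdjoint _)
  have h_mul : (H : Unitization ℂ A) * y * x = H := by
    rw [h_eq, ha, Unitization.inr_mul, Unitization.inr_mul]
    simp only [mul_assoc] at hy ⊢
    rw [hy]
  have h_xH : ‖x * H‖ ^ 2 ≤ δ * ‖H‖ ^ 2 := by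
    have e : star (x * H) * (x * H) = cfcₙ (fun r => h r * r * h r) a := by
      rw [cfcₙ_mul (fun r => h r * r) h a (by fun_prop) (by simp) (by fun_prop) (by simp [h]),
        cfcₙ_mul h (fun r => r) a hh.continuousOn (by simp [h]) continuousOn_id rfl,
        cfcₙ_id' ℝ a hsa, star_mul, ← hH, hHsa, ha]
      simp only [mul_assoc]
    rw [sq, ← CStarRing.norm_star_mul_self, e]
    refine norm_cfcₙ_le fun r hr => ?_
    have hr0 : 0 ≤ r := star_mul_self_quasispectrum_nonneg x hr
    have hrH : ‖h r‖ ≤ ‖H‖ := norm_apply_le_norm_cfcₙ h a hr hh.continuousOn (by simp [h]) hsa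
    have hsq : ‖h r * r * h r‖ = r * ‖h r‖ ^ 2 := by
      rw [norm_mul, norm_mul, Real.norm_of_nonneg hr0]; ring
    rw [hsq]
    rcases le_or_gt δ r with hδr | hδr
    · have : h r = 0 := by simp [h, k, hδr]
      rw [this]
      simpa using mul_nonneg hδ (sq_nonneg ‖H‖)
    · gcongr
  have h_bound : ‖H‖ ^ 2 ≤ C * ‖H‖ * ‖x * H‖ := by
    have e : ((star H * H : A) : Unitization ℂ A) = H * y * ((x * H : A) : Unitization ℂ A) := by
      rw [hHsa, Unitization.inr_mul, Unitization.inr_mul, ← mul_assoc, h_mul]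
    rw [sq, ← CStarRing.norm_star_mul_self, ← Unitization.norm_inr (𝕜 := ℂ), e]
    refine (norm_mul_le _ _).trans ?_
    rw [Unitization.norm_inr]
    gcongr
    refine (norm_mul_le _ _).trans ?_
    rw [Unitization.norm_inr, mul_comm]
    gcongr
  have hH0 : H = 0 := by
    by_contra hne
    have hpos : 0 < ‖H‖ := norm_pos_iff.2 hne
    have h1 : ‖H‖ ≤ C * ‖x * H‖ := by
      have : ‖H‖ * ‖H‖ ≤ ‖H‖ * (C * ‖x * H‖) := by linarith
      exact le_of_mul_le_mul_left this hpos
    have h2 : ‖H‖ ^ 2 ≤ C ^ 2 * δ * ‖H‖ ^ 2 := by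
      calc ‖H‖ ^ 2 ≤ (C * ‖x * H‖) ^ 2 := by gcongr
        _ = C ^ 2 * ‖x * H‖ ^ 2 := by ring
        _ ≤ C ^ 2 * (δ * ‖H‖ ^ 2) := by gcongr
        _ = _ := by ring
    have : 0 < ‖H‖ ^ 2 := by positivity
    nlinarith
  have hs0 : ‖h s‖ ≤ ‖H‖ := norm_apply_le_norm_cfcₙ h a hs hh.continuousOn (by simp [h]) hsa
  rw [hH0, norm_zero, norm_le_zero_iff] at hs0
  by_contra! hcon
  have : 0 < max 0 (δ - s) := lt_max_of_lt_right (by linarith [hcon.2])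
  simp only [h, k, mul_eq_zero, hcon.1, this.ne', or_self] at hs0

/-- The function `r ↦ r ^ (-1/2)` on `[δ, ∞)`, extended continuously by `0` at `0`. -/
noncomputable def truncatedInvSqrt (δ r : ℝ) : ℝ := r / (max r δ * √(max r δ))

theorem continuous_truncatedInvSqrt {δ : ℝ} (hδ : 0 < δ) : Continuous (truncatedInvSqrt δ) := by
  unfold truncatedInvSqrt
  refine Continuous.div (by fun_prop) (by fun_prop) fun r => ?_
  have : 0 < max r δ := lt_max_of_lt_right hδ
  positivity

theorem truncatedInvSqrt_zero (δ : ℝ) : truncatedInvSqrt δ 0 = 0 := by simp [truncatedInvSqrt]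

theorem truncatedInvSqrt_mul_self_mul {δ r : ℝ} (hδ : 0 < δ) (hr : δ ≤ r) :
    truncatedInvSqrt δ r * r * truncatedInvSqrt δ r = 1 := by
  have hr0 : 0 < r := hδ.trans_le hr
  have hsq : √r * √r = r := Real.mul_self_sqrt hr0.le
  have : √r ≠ 0 := by positivity
  rw [truncatedInvSqrt, max_eq_left hr]
  field_simp
  rw [sq, hsq]

/-- The partial isometry in the polar decomposition of `x`, provided that the quasispectrum of
`star x * x` does not meet `(0, δ)`. -/
noncomputable def polarPart (δ : ℝ) (x : A) : A := x * cfcₙ (truncatedInvSqrt δ) (star x * x)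

theorem continuous_polarPart {δ : ℝ} (hδ : 0 < δ) : Continuous (polarPart δ : A → A) := by
  refine continuous_id.mul ?_
  exact Continuous.cfcₙ_of_mem_nhdsSet (s := Set.univ) _ Filter.univ_mem (by fun_prop)
    (fun x => IsSelfAdjoint.star_mul_self x) (continuous_truncatedInvSqrt hδ).continuousOn
    (truncatedInvSqrt_zero δ)

theorem isPartialIsometry_polarPart {δ : ℝ} (hδ : 0 < δ) {x : A}
    (hx : ∀ s ∈ quasispectrum ℝ (star x * x), s = 0 ∨ δ ≤ s) :
    IsPartialIsometry (polarPart δ x) := by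
  set a := star x * x with ha
  have hsa : IsSelfAdjoint a := IsSelfAdjoint.star_mul_self x
  set g := truncatedInvSqrt δ with hg
  have hgc : Continuous g := continuous_truncatedInvSqrt hδ
  have hg0 : g 0 = 0 := truncatedInvSqrt_zero δ
  have e : star (polarPart δ x) * polarPart δ x = cfcₙ (fun r => g r * r * g r) a := by
    have hs : star (cfcₙ g a) = cfcₙ g a := (cfcₙ_predicate g a : IsSelfAdjoint _)
    rw [cfcₙ_mul (fun r => g r * r) g a (by fun_prop) (by simp) (by fun_prop) hg0,
      cfcₙ_mul g (fun r => r) a hgc.continuousOn hg0 continuousOn_id rfl,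
      cfcₙ_id' ℝ a hsa, polarPart, star_mul, ← ha, ← hg, hs, ha]
    simp only [mul_assoc]
  rw [IsPartialIsometry, e]
  refine ⟨?_, cfcₙ_predicate _ a⟩
  rw [IsIdempotentElem, ← cfcₙ_mul _ _ a (by fun_prop) (by simp) (by fun_prop) (by simp)]
  refine cfcₙ_congr fun s hs => ?_
  rcases hx s hs with rfl | h
  · simp
  · simp only [hg, truncatedInvSqrt_mul_self_mul hδ h, mul_one]

theorem IsPartialIsometry.polarPart_eq {u : A} (hu : IsPartialIsometry u) {δ : ℝ} (hδ : δ ≤ 1) :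
    polarPart δ u = u := by
  -- On `{0, 1}` the function agrees with the identity.
  have h : cfcₙ (truncatedInvSqrt δ) (star u * u) = cfcₙ (fun r : ℝ => r) (star u * u) := by
    refine cfcₙ_congr fun s hs => ?_
    rcases IsIdempotentElem.quasispectrum_subset ℝ hu.isIdempotentElem hs with rfl | rfl
    · simp [truncatedInvSqrt]
    · simp [truncatedInvSqrt, max_eq_left hδ]
  rw [polarPart, h, cfcₙ_id' ℝ _ hu.isSelfAdjoint, hu.mul_star_mul_self]

end PolarPart

/-! ### Construction of the homotopy -/

section Homotopy

variable {A : Type w} [NonUnitalCStarAlgebra A] {u v : A}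

theorem IsPartialIsometry.hasGeneralizedInverse_perturbation (hv : IsPartialIsometry v) {l r : A}
    {c : ℝ} (hc : c < 1) (hl : ‖l‖ ≤ c) (hr : ‖r‖ ≤ c) :
    HasGeneralizedInverse ((1 - c)⁻¹ ^ 2) (v + l * v + v * r + l * v * r) := by
  obtain ⟨n, hn, -, hnc⟩ := exists_inverse_one_add (B := Unitization ℂ A) hc
    (x := (l : Unitization ℂ A)) (by rwa [Unitization.norm_inr])
  obtain ⟨m, -, hm, hmc⟩ := exists_inverse_one_add (B := Unitization ℂ A) hc
    (x := (r : Unitization ℂ A)) (by rwa [Unitization.norm_inr])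
  have hx : ((v + l * v + v * r + l * v * r : A) : Unitization ℂ A) = (1 + l) * v * (1 + r) := by
    simp only [Unitization.inr_add, Unitization.inr_mul]
    noncomm_ring
  have hvv : (v : Unitization ℂ A) * (star v : A) * v = v := by
    rw [← Unitization.inr_mul, ← Unitization.inr_mul, mul_assoc, hv.mul_star_mul_self]
  refine ⟨m * (star v : A) * n, ?_, ?_⟩
  · rw [hx]
    calc _ = (1 + (l : Unitization ℂ A)) * v * ((1 + r) * m) * (star v : A) * (n * (1 + l)) * v
            * (1 + r) := by simp only [mul_assoc]
      _ = (1 + (l : Unitization ℂ A)) * (v * (star v : A) * v) * (1 + r) := by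
          rw [hm, hn]; simp only [mul_assoc, mul_one]
      _ = _ := by rw [hvv]
  · have hpos : 0 < (1 - c)⁻¹ := inv_pos.2 (by linarith)
    calc _ ≤ ‖m‖ * ‖((star v : A) : Unitization ℂ A)‖ * ‖n‖ :=
          (norm_mul_le _ _).trans (by gcongr; exact norm_mul_le _ _)
      _ ≤ (1 - c)⁻¹ * 1 * (1 - c)⁻¹ := by
          rw [Unitization.norm_inr, norm_star]
          gcongr
          exact hv.norm_le_one
      _ = _ := by ring

theorem IsPartialIsometry.homotopic_polarPart_perturbation (hv : IsPartialIsometry v) {l r : A}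
    {c : ℝ} (hc : c < 1) (hl : ‖l‖ ≤ c) (hr : ‖r‖ ≤ c) {δ : ℝ} (hδ : 0 < δ) (hδ1 : δ ≤ 1)
    (hcδ : ((1 - c)⁻¹ ^ 2) ^ 2 * δ < 1) :
    HomotopicThroughPartialIsometries v (polarPart δ (v + l * v + v * r + l * v * r)) := by
  let γ : ℝ → A := fun t => polarPart δ (v + (t • l) * v + v * (t • r) + (t • l) * v * (t • r))
  have hγ : Continuous γ := (continuous_polarPart hδ).comp (by fun_prop)
  refine JoinedIn.ofLine (f := γ) hγ.continuousOn ?_ (by simp [γ]) ?_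
  · simp [γ, hv.polarPart_eq hδ1]
  · rintro _ ⟨t, ht, rfl⟩
    have hsmul : ∀ a : A, ‖a‖ ≤ c → ‖t • a‖ ≤ c := fun a ha => by
      rw [norm_smul, Real.norm_of_nonneg ht.1]
      exact (mul_le_of_le_one_left (norm_nonneg a) ht.2).trans ha
    exact isPartialIsometry_polarPart hδ fun s hs =>
      (hv.hasGeneralizedInverse_perturbation hc (hsmul l hl)
        (hsmul r hr)).quasispectrum_gap hδ.le hcδ hs

theorem IsPartialIsometry.norm_support_sub_mul_le (hu : IsPartialIsometry u)
    (hv : IsPartialIsometry v) :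
    ‖star v * v - star v * v * (star u * u)‖ ≤ ‖u - v‖ := by
  have hp : IsStarProjection ((star u * u : A) : Unitization ℂ A) :=
    hu.map (Unitization.inrNonUnitalStarAlgHom ℂ A)
  have h1 : ‖v - v * (star u * u)‖ ≤ ‖u - v‖ := by
    -- `u (1 - u* u) = 0`, so `v` may be replaced by `v - u`.
    have e : ((v - v * (star u * u) : A) : Unitization ℂ A)
        = ((v - u : A) : Unitization ℂ A) * (1 - ((star u * u : A) : Unitization ℂ A)) := by
      rw [mul_sub, mul_one, ← Unitization.inr_mul, sub_mul, hu.mul_star_mul_self,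
        ← Unitization.inr_sub]
      congr 1
      abel
    rw [← Unitization.norm_inr (𝕜 := ℂ), e, norm_sub_rev u v]
    refine (norm_mul_le _ _).trans ?_
    rw [Unitization.norm_inr]
    exact mul_le_of_le_one_right (norm_nonneg _) (IsStarProjection.norm_le _ hp.one_sub)
  have e : star v * v - star v * v * (star u * u) = star v * (v - v * (star u * u)) := by
    noncomm_ring
  rw [e]
  refine (norm_mul_le _ _).trans ?_
  rw [norm_star]
  exact (mul_le_of_le_one_left (norm_nonneg _) hv.norm_le_one).trans h1

theorem IsPartialIsometry.norm_support_sub_le (hu : IsPartialIsometry u)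
    (hv : IsPartialIsometry v) : ‖star u * u - star v * v‖ ≤ ‖u - v‖ := by
  have hp : IsStarProjection ((star u * u : A) : Unitization ℂ A) :=
    hu.map (Unitization.inrNonUnitalStarAlgHom ℂ A)
  have hq : IsStarProjection ((star v * v : A) : Unitization ℂ A) :=
    hv.map (Unitization.inrNonUnitalStarAlgHom ℂ A)
  have h := hp.norm_sub_sq_le hq
  simp only [← Unitization.inr_mul, ← Unitization.inr_sub, Unitization.norm_inr] at h
  have h1 : ‖star u * u - star v * v * (star u * u)‖ ≤ ‖u - v‖ := by
    have e : star u * u - star v * v * (star u * u)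
        = star (star u * u - star u * u * (star v * v)) := by
      simp only [star_sub, star_mul, star_star, mul_assoc]
    rw [e, norm_star, norm_sub_rev u v]
    exact hv.norm_support_sub_mul_le hu
  have h2 := hu.norm_support_sub_mul_le hv
  refine (sq_le_sq₀ (norm_nonneg _) (norm_nonneg _)).1 (h.trans (max_le ?_ ?_)) <;> gcongr

/-- Adding `1` gives `q p + (1 - q)(1 - p)`, the standard intertwiner of `p` and `q`. The element
and `p - q` have the same `star x * x`. -/
theorem norm_rotation (p q : A) (hp : IsStarProjection p) (hq : IsStarProjection q) :
    ‖q * p + q * p - q - p‖ = ‖p - q‖ := by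
  have hpp : p * p = p := hp.isIdempotentElem
  have hqq : q * q = q := hq.isIdempotentElem
  have hps : star p = p := hp.isSelfAdjoint
  have hqs : star q = q := hq.isSelfAdjoint
  have e : star (q * p + q * p - q - p) * (q * p + q * p - q - p) = star (p - q) * (p - q) := by
    simp only [star_sub, star_add, star_mul, hps, hqs, mul_sub, sub_mul, mul_add, add_mul,
      mul_assoc, hpp, hqq]
    simp only [← mul_assoc q q, hqq]
    abel
  rw [← mul_self_inj (norm_nonneg _) (norm_nonneg _), ← CStarRing.norm_star_mul_self, e,
    CStarRing.norm_star_mul_self]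

theorem IsPartialIsometry.homotopic_of_norm_sub_lt_one (hu : IsPartialIsometry u)
    (hv : IsPartialIsometry v) (huv : ‖u - v‖ < 1) : HomotopicThroughPartialIsometries u v := by
  set c := ‖u - v‖ with hc
  have hc0 : 0 ≤ c := norm_nonneg _
  -- With `C = (1 - c)⁻²` this makes `C² δ = 1/2`.
  let δ : ℝ := (1 - c) ^ 4 / 2
  have hδ : 0 < δ := by
    have : 0 < 1 - c := by linarith
    positivity
  have hδ1 : δ ≤ 1 := by
    have : (1 - c) ^ 4 ≤ 1 := pow_le_one₀ (by linarith) (by linarith)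
    simp only [δ]; linarith
  have hcδ : ((1 - c)⁻¹ ^ 2) ^ 2 * δ < 1 := by
    have : 1 - c ≠ 0 := by linarith
    simp only [δ]
    field_simp
    norm_num
  have hup := hu.mul_star_mul_self
  have hvp := hv.mul_star_mul_self
  set p := star u * u with hp
  set q := star v * v with hq
  set e := u * star u with he
  set f := v * star v with hf
  have hep : IsStarProjection e := by simpa [IsPartialIsometry] using hu.isPartialIsometry_star
  have hfp : IsStarProjection f := by simpa [IsPartialIsometry] using hv.isPartialIsometry_star
  have heu : e * u = u := by rw [he, mul_assoc, ← hp, hup]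
  have hfv : f * v = v := by rw [hf, mul_assoc, ← hq, hvp]
  have h1 : HomotopicThroughPartialIsometries u (polarPart δ (e * v * p)) := by
    -- `u (1 + r) = u + e (v - u) p = e v p`.
    have := hu.homotopic_polarPart_perturbation (l := 0) (r := star u * (v - u) * p) huv
      (by simpa using hc0) ?_ hδ hδ1 hcδ
    · convert this using 2
      have : u * (star u * (v - u) * p) = e * v * p - e * u * p := by rw [he]; noncomm_ring
      rw [this, heu, hup]
      noncomm_ring
    · calc ‖star u * (v - u) * p‖ ≤ ‖star u‖ * ‖v - u‖ * ‖p‖ :=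
            (norm_mul_le _ _).trans (by gcongr; exact norm_mul_le _ _)
        _ ≤ 1 * ‖v - u‖ * 1 := by
            gcongr
            · rw [norm_star]; exact hu.norm_le_one
            · exact IsStarProjection.norm_le _ hu
        _ = c := by rw [hc, norm_sub_rev]; ring
  have h2 : HomotopicThroughPartialIsometries v (polarPart δ (e * v * p)) := by
    -- Since `f v = v = v q`, these choices give `(1 + l) v = e v` and `v (1 + r) = v p`.
    have := hv.homotopic_polarPart_perturbation (l := e * f + e * f - e - f)
      (r := q * p + q * p - q - p) huv ?_ ?_ hδ hδ1 hcδ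
    · convert this using 2
      have hl : v + (e * f + e * f - e - f) * v = e * v := by
        simp only [sub_mul, add_mul, mul_assoc, hfv]; abel
      have hr : v + v * (q * p + q * p - q - p) = v * p := by
        simp only [mul_sub, mul_add, ← mul_assoc, hvp]; abel
      rw [mul_assoc, ← hr, mul_add, ← mul_assoc, ← hl]
      noncomm_ring
    · rw [norm_rotation f e hfp hep, norm_sub_rev]
      have := hu.isPartialIsometry_star.norm_support_sub_le hv.isPartialIsometry_star
      rwa [star_star, star_star, ← star_sub, norm_star] at this
    · rw [norm_rotation p q hu hv]
      exact hu.norm_support_sub_le hv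
  exact h1.trans h2.symm

end Homotopy

theorem theorem4 :
    (∀ (A : Type w) [NonUnitalCStarAlgebra A] (u v : A),
      IsPartialIsometry u → IsPartialIsometry v → ‖u - v‖ < 1 →
        HomotopicThroughPartialIsometries u v) ∧
    (∀ (A : Type w) [NonUnitalCStarAlgebra A] (u v : A),
      u = 0 → IsPartialIsometry v → v ≠ 0 →
        IsPartialIsometry u ∧ ‖u - v‖ = 1 ∧ ¬ HomotopicThroughPartialIsometries u v) ∧
    (∃ (A : Type w) (_ : NonUnitalCStarAlgebra A) (v : A), IsPartialIsometry v ∧ v ≠ 0) := by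
  refine ⟨fun A _ u v hu hv huv => hu.homotopic_of_norm_sub_lt_one hv huv, ?_, ?_⟩
  · rintro A _ u v rfl hv hv0
    refine ⟨.zero, ?_, IsPartialIsometry.not_homotopic_zero hv0⟩
    rw [zero_sub, norm_neg, hv.norm_eq_one hv0]
  · refine ⟨PUnit.{w + 1} → ℂ, inferInstance, 1, ?_, one_ne_zero⟩
    simp [IsPartialIsometry, IsStarProjection.one]
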